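/- Let $[n]=\{1,\dots,n\}$ and let $\Pi$ be the set of permutations of $[n]$. For $\pi,\pi'\in\Pi$ let $\mathrm{Swap}(\pi,\pi')$ be the minimum number of coordinate swaps that turn $\pi$ into $\pi'$, where a coordinate swap changes a permutation in exactly two coordinates. For $\gamma>0$, a random permutation $\mathcal S$ of $[n]$ is a $\gamma$-imperfect shuffler if $\Pr[\mathcal S=\pi]\le e^{\gamma\,\mathrm{Swap}(\pi,\pi')}\Pr[\mathcal S=\pi']$ for all $\pi,\pi'\in\Pi$. A randomized algorithm $M$ is $(\varepsilon,\delta)$-DP if $\Pr[M(x)\in T]\le e^{\varepsilon}\Pr[M(x')\in T]+\delta$ for all neighboring inputs $x,x'$ and all measurable sets $T$ of outputs; two datasets in $\mathcal D^n$ are neighboring if they differ in at most one coordinate. An $\varepsilon_0$-DP local randomizer is a randomized map $R:\mathcal D\to\mathcal X$ with $\Pr[R(d)\in T]\le e^{\varepsilon_0}\Pr[R(d')\in T]$ for all $d,d'\in\mathcal D$ and all measurable $T\subseteq\mathcal X$. **Theorem.** There is a universal constant $C>0$ such that the following holds for every domain $\mathcal D$, every range space (measurable space) $\mathcal X$, every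 $n\ge 1$, $\varepsilon_0>0$, $\gamma>0$ and $\delta\in(0,1)$ with $$\varepsilon_0\le\log\left(\frac{n}{16\log(2/\delta)}\right),$$ and every $\gamma$-imperfect shuffler $\mathcal S$ on $[n]$. Put $$\varepsilon=C\cdot\frac{(1-e^{-\varepsilon_0})\,e^{\varepsilon_0/2}\sqrt{\log(1/\delta)}}{\sqrt n}.$$ 1. If $\mathcal R^{(1)},\dots,\mathcal R^{(n)}:\mathcal D\to\mathcal X$ are $\varepsilon_0$-DP local randomizers, then the composed protocol $\mathcal S(\mathcal R^{(1)},\dots,\mathcal R^{(n)})$, which on input $x\in\mathcal D^n$ samples $\pi$ from $\mathcal S$ and, with independent randomness, outputs $(z_1,\dots,z_n)$ with $z_i=\mathcal R^{(i)}(x_{\pi(i)})$, is $(\varepsilon+\gamma,\delta)$-DP. 2. If $\mathcal R:\mathcal D\to\mathcal X$ is an $\varepsilon_0$-DP local randomizer, then the protocol in which each user $j$ independently computes the message $y_j=\mathcal R(x_j)$, the shuffler independently samples $\pi$ from $\mathcal S$, and $(y_{\pi(1)},\dots,y_{\pi(n)})$ is output, is $(\varepsilon+\gamma,\delta)$-DP.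 -/

import Mathlib

open MeasureTheory

/-- `π'` results from `π` by one coordinate swap: the two permutations of `[n]` agree on all
except exactly two coordinates. -/
def IsCoordSwap {n : ℕ} (π π' : Equiv.Perm (Fin n)) : Prop :=
  (Finset.univ.filter (fun i => π i ≠ π' i)).card = 2

/-- `π'` can be obtained from `π` by `k` successive coordinate swaps. -/
def SwapReach {n : ℕ} : ℕ → Equiv.Perm (Fin n) → Equiv.Perm (Fin n) → Prop
  | 0, π, π' => π = π'
  | k + 1, π, π' => ∃ ρ, SwapReach k π ρ ∧ IsCoordSwap ρ π'

/-- `Swap(π, π')`: the minimum number of coordinate swaps that turn `π` into `π'`. -/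
noncomputable def swapDist {n : ℕ} (π π' : Equiv.Perm (Fin n)) : ℕ :=
  sInf {k : ℕ | SwapReach k π π'}

/-- The minimum in `swapDist` is over a nonempty set. -/
theorem exists_swapReach {n : ℕ} (π π' : Equiv.Perm (Fin n)) : ∃ k, SwapReach k π π' := by
  suffices h : ∀ σ : Equiv.Perm (Fin n), ∃ k, SwapReach k π (σ * π) by
    simpa using h (π' * π⁻¹)
  intro σ
  induction σ using Equiv.Perm.swap_induction_on with
  | one => exact ⟨0, by simp [SwapReach]⟩
  | swap_mul f x y hxy ih =>
    obtain ⟨k, hk⟩ := ih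
    refine ⟨k + 1, f * π, hk, ?_⟩
    have he : (Finset.univ.filter
        (fun i => (f * π) i ≠ (Equiv.swap x y * f * π) i)) =
        {(f * π)⁻¹ x, (f * π)⁻¹ y} := by
      ext i
      have hx : i = (f * π)⁻¹ x ↔ (f * π) i = x := Equiv.Perm.eq_inv_iff_eq
      have hy : i = (f * π)⁻¹ y ↔ (f * π) i = y := Equiv.Perm.eq_inv_iff_eq
      rw [Finset.mem_filter, Finset.mem_insert, Finset.mem_singleton, hx, hy, mul_assoc,
        Equiv.Perm.mul_apply (Equiv.swap x y)]
      generalize (f * π) i = z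
      simp only [Finset.mem_univ, true_and]
      rw [ne_comm, Equiv.swap_apply_ne_self_iff]
      tauto
    unfold IsCoordSwap
    rw [he]
    exact Finset.card_pair (fun h => hxy ((f * π)⁻¹.injective h))

/-- A shuffler (a random permutation of `[n]`) is a `γ`-imperfect shuffler if
`Pr[S = π] ≤ exp (γ * Swap(π, π')) * Pr[S = π']` for all permutations `π, π'`. -/
def IsImperfectShuffler {n : ℕ} (γ : ℝ) (S : PMF (Equiv.Perm (Fin n))) : Prop :=
  ∀ π π' : Equiv.Perm (Fin n),
    S π ≤ ENNReal.ofReal (Real.exp (γ * swapDist π π')) * S π'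

/-- `(ε, δ)`-differential privacy of the randomized algorithm `M` (`M x` is the law of its output
on input `x`) with respect to a neighbouring relation `nbr` on inputs. -/
def IsDP {A Y : Type*} [MeasurableSpace Y] (nbr : A → A → Prop) (M : A → Measure Y)
    (ε δ : ℝ) : Prop :=
  ∀ x x' : A, nbr x x' → ∀ T : Set Y, MeasurableSet T →
    M x T ≤ ENNReal.ofReal (Real.exp ε) * M x' T + ENNReal.ofReal δ

/-- Neighbouring datasets of `n` users: they differ in the data of at most one user. -/
def Neighboring {n : ℕ} {D : Type*} (x x' : Fin n → D) : Prop :=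
  ∃ i, ∀ j, j ≠ i → x j = x' j

/-- An `ε₀`-DP local randomizer: a randomized algorithm on the datum of a single user that is
`(ε₀, 0)`-DP, any two data being neighbouring. -/
def IsLocalRandomizer {D X : Type*} [MeasurableSpace X] (ε₀ : ℝ) (R : D → Measure X) : Prop :=
  (∀ d, IsProbabilityMeasure (R d)) ∧ IsDP (fun _ _ => True) R ε₀ 0

/-- The law of the composed protocol `S(R⁽¹⁾, …, R⁽ⁿ⁾)` on the dataset `x`: sample a permutation
`π` from the shuffler and, with independent randomness, output
`(z₁, …, zₙ)` with `zᵢ = R⁽ⁱ⁾(x_{π(i)})`. -/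
noncomputable def composedProtocol {n : ℕ} {D X : Type*} [MeasurableSpace X]
    (S : PMF (Equiv.Perm (Fin n))) (R : Fin n → D → Measure X) (x : Fin n → D) :
    Measure (Fin n → X) :=
  ∑ π : Equiv.Perm (Fin n), S π • Measure.pi (fun i => R i (x (π i)))

/-- The law of the protocol in which every user `j` sends the message `yⱼ = R(xⱼ)`
(independently), the shuffler independently samples `π`, and `(y_{π(1)}, …, y_{π(n)})` is
output. -/
noncomputable def randomizeThenShuffle {n : ℕ} {D X : Type*} [MeasurableSpace X]
    (S : PMF (Equiv.Perm (Fin n))) (R : D → Measure X) (x : Fin n → D) :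
    Measure (Fin n → X) :=
  ∑ π : Equiv.Perm (Fin n),
    S π • (Measure.pi (fun j => R (x j))).map (fun y i => y (π i))

/-! Put `E = exp ε₀` and let `u` be the user whose datum changes. At each position the randomizer
contains two sub-measures `P true`, `P false` of mass `1/(2E)` that do not depend on the sender's
datum, and the two possible laws of `u`'s message mix these same two "clones" with exchanged weights
(`exists_clone_decomposition`). Expanding the product measures yields a sum over label vectors `L`
on the output positions. For fixed `L`, moving `u` between clone-labelled positions is one
transposition: the product measure is unchanged and the shuffler's probability changes by at most
`exp γ`. Hence, up to this single factor, `u` is uniform among the clones (`labelCount_mul_sum_le`),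
and changing its datum costs only a ratio of two mixtures of the label counts
(`mixture_le_of_ratio_le`). That ratio is near 1 when clones are plentiful and `false` does not
greatly outnumber `true` (`label_ratio_le`). The other `L` are rare by Chernoff bounds, in which the
shuffler plays no role because counts are permutation invariant. `composedProtocol_real_le`
assembles this; the second protocol is the first with equal randomizers. -/

open scoped NNReal

/-! ### Transpositions and the shuffler condition -/

/-- Composing a permutation with a transposition is (at most) one coordinate swap. -/
theorem swapDist_mul_swap_le {n : ℕ} (π : Equiv.Perm (Fin n)) {i k : Fin n} (hik : i ≠ k) :
    swapDist π (π * Equiv.swap i k) ≤ 1 := by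
  refine Nat.sInf_le ⟨π, rfl, ?_⟩
  have he : (Finset.univ.filter (fun j => π j ≠ (π * Equiv.swap i k) j)) = {i, k} := by
    ext j
    rw [Finset.mem_filter, Equiv.Perm.mul_apply, π.injective.ne_iff, ne_comm,
      Equiv.swap_apply_ne_self_iff]
    simp [hik]
  rw [IsCoordSwap, he, Finset.card_pair hik]

theorem IsImperfectShuffler.toReal_le_swap {n : ℕ} {γ : ℝ} (hγ : 0 ≤ γ)
    {S : PMF (Equiv.Perm (Fin n))} (hS : IsImperfectShuffler γ S) (π : Equiv.Perm (Fin n))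
    {i k : Fin n} (hik : i ≠ k) :
    (S π).toReal ≤ Real.exp γ * (S (π * Equiv.swap i k)).toReal := by
  have h := ENNReal.toReal_mono (ENNReal.mul_ne_top ENNReal.ofReal_ne_top (S.apply_ne_top _))
    (hS π (π * Equiv.swap i k))
  rw [ENNReal.toReal_mul, ENNReal.toReal_ofReal (Real.exp_pos _).le] at h
  refine h.trans (mul_le_mul_of_nonneg_right (Real.exp_le_exp.2 ?_) ENNReal.toReal_nonneg)
  have : (swapDist π (π * Equiv.swap i k) : ℝ) ≤ 1 := by
    exact_mod_cast swapDist_mul_swap_le π hik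
  exact mul_le_of_le_one_right hγ this

/-! ### Finite measures: subtraction and product expansion -/

section Measures

variable {X : Type*} [MeasurableSpace X]

theorem measureReal_sum_apply {ι : Type*} (s : Finset ι) (μ : ι → Measure X)
    [∀ i, IsFiniteMeasure (μ i)] (T : Set X) :
    (∑ i ∈ s, μ i).real T = ∑ i ∈ s, (μ i).real T := by
  rw [measureReal_def, Measure.finsetSum_apply, ENNReal.toReal_sum (fun i _ => measure_ne_top _ _)]
  rfl

theorem measure_eq_of_real_eq {μ ν : Measure X} [IsFiniteMeasure μ] [IsFiniteMeasure ν]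
    (h : ∀ T, MeasurableSet T → μ.real T = ν.real T) : μ = ν :=
  Measure.ext fun T hT => (measureReal_eq_measureReal_iff).1 (h T hT)

theorem exists_add_eq_of_real_le {μ ν : Measure X} [IsFiniteMeasure μ] [IsFiniteMeasure ν]
    (h : ∀ T, MeasurableSet T → μ.real T ≤ ν.real T) :
    ∃ ρ : Measure X, IsFiniteMeasure ρ ∧ ∀ T, ρ.real T + μ.real T = ν.real T := by
  refine ⟨ν - μ, inferInstance, fun T => ?_⟩
  have hle : μ ≤ ν := Measure.le_iff.2 fun T hT =>
    (ENNReal.toReal_le_toReal (measure_ne_top _ _) (measure_ne_top _ _)).1 (h T hT)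
  rw [← measureReal_add_apply, Measure.sub_add_cancel_of_le hle]

/-- A product of finite sums of measures expands multilinearly. -/
theorem pi_sum_eq_sum_pi {ι κ : Type*} [Fintype ι] [DecidableEq ι] [Fintype κ]
    (ν : ι → κ → Measure X) [∀ i c, IsFiniteMeasure (ν i c)] :
    Measure.pi (fun i => ∑ c, ν i c) = ∑ L : ι → κ, Measure.pi (fun i => ν i (L i)) := by
  refine Measure.pi_eq fun s _ => ?_
  simp only [Measure.finsetSum_apply, Measure.pi_pi]
  rw [Finset.prod_univ_sum, Fintype.piFinset_univ]

/-- Scaling one factor scales the product measure. -/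
theorem pi_ite_smul {ι : Type*} [Fintype ι] [DecidableEq ι] (ν : ι → Measure X)
    [∀ i, IsFiniteMeasure (ν i)] (w : ι → ℝ≥0) (i₀ : ι) :
    Measure.pi (fun i => (if i = i₀ then w i else 1) • ν i) = w i₀ • Measure.pi ν := by
  refine Measure.pi_eq fun s _ => ?_
  simp only [Measure.smul_apply, Measure.pi_pi, ENNReal.smul_def, smul_eq_mul]
  rw [Finset.prod_mul_distrib]
  congr 1
  rw [Finset.prod_eq_single i₀ (by intro b _ hb; simp [hb]) (by simp)]
  simp

end Measures

/-! ### Clone decomposition of a local randomizer -/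

/-- The relative weight of a label for a user holding the distinguished datum `v`. -/
noncomputable def labelWeight (E : ℝ≥0) (v : Bool) : Option Bool → ℝ≥0
  | none => 1
  | some c => if c = v then 2 * E ^ 2 / (E + 1) else 2 * E / (E + 1)

/-- The mass of the component carrying a given label, before weighting; the distinguished user
(`special`) has no unlabelled component. -/
noncomputable def labelMass (E : ℝ≥0) (special : Prop) [Decidable special] : Option Bool → ℝ
  | none => if special then 0 else 1 - 1 / E
  | some _ => 1 / (2 * E)

/-- Every local randomizer is a mixture of two "clone" distributions of the distinguished inputs
`a` and `b` with a remainder depending on the actual input. -/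
theorem exists_clone_decomposition {D X : Type*} [MeasurableSpace X] {E : ℝ≥0} (hE : 1 < E)
    {R : D → Measure X} (hR : ∀ d, IsProbabilityMeasure (R d))
    (hE' : ∀ d d' T, MeasurableSet T → (R d).real T ≤ E * (R d').real T) (a : Bool → D) :
    ∃ (P : Bool → Measure X) (Q : D → Measure X),
      (∀ c, IsFiniteMeasure (P c)) ∧ (∀ d, IsFiniteMeasure (Q d)) ∧
      (∀ c, (P c).real Set.univ = 1 / (2 * E)) ∧
      (∀ d, (Q d).real Set.univ = 1 - 1 / E) ∧
      (∀ d, R d = Q d + (P true + P false)) ∧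
      ∀ v, R (a v) = labelWeight E v (some true) • P true +
        labelWeight E v (some false) • P false := by
  have h1 : (1 : ℝ) < E := by exact_mod_cast hE
  have h0 : (0 : ℝ) < E := by linarith
  have hk : (0 : ℝ) < E - 1 := by linarith
  -- `ρ v = E • R (a v) - R (a (!v))`, up to scale the solution of the 2×2 system expressing both `R
  -- (a v)` through `P`.
  have hD : ∀ v, ∃ ρ : Measure X, IsFiniteMeasure ρ ∧
      ∀ T, ρ.real T + (R (a (!v))).real T = (E • R (a v)).real T := fun v =>
    exists_add_eq_of_real_le fun T hT => by
      rw [measureReal_nnreal_smul_apply]; exact hE' _ _ T hT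
  choose ρ hρf hρ using hD
  simp only [measureReal_nnreal_smul_apply] at hρ
  -- With this scale the clones add up to the average of the two `R (a v)` divided by `E`, which
  -- lies below every `R d`.
  set k : ℝ≥0 := 1 / (2 * E * (E - 1)) with hkdef
  have hkr : (k : ℝ) = 1 / (2 * E * (E - 1)) := by
    rw [hkdef]; push_cast [NNReal.coe_sub hE.le]; rfl
  have hPsum : ∀ T, (k • ρ true).real T + (k • ρ false).real T =
      ((R (a true)).real T + (R (a false)).real T) / (2 * E) := by
    intro T
    have ht := hρ true T
    have hf := hρ false T
    simp only [Bool.not_true, Bool.not_false] at ht hf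
    rw [measureReal_nnreal_smul_apply, measureReal_nnreal_smul_apply, hkr,
      eq_sub_of_add_eq ht, eq_sub_of_add_eq hf]
    field_simp
    ring
  have hQ : ∀ d, ∃ q : Measure X, IsFiniteMeasure q ∧
      ∀ T, q.real T + (k • ρ true + k • ρ false).real T = (R d).real T := fun d =>
    exists_add_eq_of_real_le fun T hT => by
      rw [measureReal_add_apply, hPsum, div_le_iff₀ (by positivity)]
      linarith [hE' (a true) d T hT, hE' (a false) d T hT]
  choose q hqf hq using hQ
  refine ⟨fun c => k • ρ c, q, fun c => inferInstance, hqf, fun c => ?_, fun d => ?_, fun d => ?_,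
    fun v => ?_⟩
  · have := hρ c Set.univ
    simp only [probReal_univ] at this
    rw [measureReal_nnreal_smul_apply, hkr, eq_sub_of_add_eq this]
    field_simp
  · have := hq d Set.univ
    rw [measureReal_add_apply, hPsum] at this
    simp only [probReal_univ] at this
    rw [eq_sub_of_add_eq this]
    field_simp
    ring
  · refine measure_eq_of_real_eq fun T _ => ?_
    rw [measureReal_add_apply, ← hq d T]
  · refine measure_eq_of_real_eq fun T _ => ?_
    have ht := hρ true T
    have hf := hρ false T
    simp only [Bool.not_true, Bool.not_false] at ht hf
    rw [measureReal_add_apply]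
    simp only [measureReal_nnreal_smul_apply]
    rw [hkr, eq_sub_of_add_eq ht, eq_sub_of_add_eq hf]
    have h2 : (E : ℝ) + 1 ≠ 0 := by positivity
    cases v <;> simp [labelWeight] <;> field_simp <;> ring

/-! ### Exchanging the distinguished user with a clone -/

section Exchange

variable {n : ℕ}

/-- The number of positions carrying the label `c`. -/
def labelCount (L : Fin n → Option Bool) (c : Bool) : ℕ :=
  (Finset.univ.filter fun k => L k = some c).card

theorem labelCount_comp_perm (L : Fin n → Option Bool) (π : Equiv.Perm (Fin n)) (c : Bool) :
    labelCount (fun i => L (π i)) c = labelCount L c := by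
  rw [labelCount, labelCount, Finset.card_filter, Finset.card_filter]
  exact Equiv.sum_comp π fun k => if L k = some c then 1 else 0

/-- Exchanging the position of `u` with another position, remembering the old position of `u`. -/
def exchange (u : Fin n) (z : Equiv.Perm (Fin n) × Fin n) : Equiv.Perm (Fin n) × Fin n :=
  (z.1 * Equiv.swap (z.1⁻¹ u) z.2, z.1⁻¹ u)

theorem exchange_fst_inv_apply (u : Fin n) (z : Equiv.Perm (Fin n) × Fin n) :
    (exchange u z).1⁻¹ u = z.2 := by
  simp [exchange]

theorem exchange_involutive (u : Fin n) : Function.Involutive (exchange u) := by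
  intro z
  have h := exchange_fst_inv_apply u z
  refine Prod.ext ?_ h
  change (exchange u z).1 * Equiv.swap ((exchange u z).1⁻¹ u) (z.1⁻¹ u) = z.1
  rw [h, exchange, mul_assoc, Equiv.swap_comm z.2, Equiv.swap_mul_self, mul_one]

/-- If one swap changes the weights `S` by a factor at most `g` and preserves `G` within labelled
positions, the two label classes of the position of `u` have comparable weights. -/
theorem labelCount_mul_sum_le {S G : Equiv.Perm (Fin n) → ℝ} {g : ℝ} {L : Fin n → Option Bool}
    (hG0 : ∀ π, 0 ≤ G π) (hS : ∀ π i k, i ≠ k → S π ≤ g * S (π * Equiv.swap i k))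
    (hG : ∀ π i k, L i ≠ none → L k ≠ none → G (π * Equiv.swap i k) = G π) (u : Fin n) :
    labelCount L true * ∑ π, (if L (π⁻¹ u) = some false then S π * G π else 0) ≤
      g * (labelCount L false * ∑ π, (if L (π⁻¹ u) = some true then S π * G π else 0)) := by
  have hrw : ∀ b c : Bool,
      (labelCount L b * ∑ π, (if L (π⁻¹ u) = some c then S π * G π else 0) : ℝ) =
      ∑ z : Equiv.Perm (Fin n) × Fin n,
        if L z.2 = some b then (if L (z.1⁻¹ u) = some c then S z.1 * G z.1 else 0) else 0 := by
    intro b c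
    rw [Fintype.sum_prod_type, Finset.mul_sum]
    refine Finset.sum_congr rfl fun π _ => ?_
    rw [← Finset.sum_filter]
    exact ((Finset.sum_const _).trans (nsmul_eq_mul _ _)).symm
  -- Both sides count pairs (permutation, marked position); `exchange u` turns "`u` on `false`, mark
  -- on `true`" into the reverse, so the sums compare termwise.
  rw [hrw, hrw, ← Equiv.sum_comp (exchange_involutive u).toPerm, Finset.mul_sum]
  refine Finset.sum_le_sum fun z _ => ?_
  rw [Function.Involutive.coe_toPerm, exchange_fst_inv_apply]
  change (if L (z.1⁻¹ u) = some true then (if L z.2 = some false then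
      S (exchange u z).1 * G (exchange u z).1 else 0) else 0) ≤
    g * if L z.2 = some false then (if L (z.1⁻¹ u) = some true then S z.1 * G z.1 else 0) else 0
  by_cases h1 : L (z.1⁻¹ u) = some true <;> by_cases h2 : L z.2 = some false <;>
    simp only [h1, h2, if_true, if_false, mul_zero, le_refl]
  rw [exchange]
  dsimp only
  rw [hG _ _ _ (by rw [h1]; simp) (by rw [h2]; simp), ← mul_assoc]
  refine mul_le_mul_of_nonneg_right ?_ (hG0 _)
  have hne : z.1⁻¹ u ≠ z.2 := fun h => by rw [h, h2] at h1; simp at h1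
  refine (hS _ _ _ hne).trans_eq ?_
  rw [mul_assoc, Equiv.swap_mul_self, mul_one]

end Exchange

/-- For exactly uniform positions `A₀ : A₁ = N₀ : N₁`, and the count ratio `ρ` transfers to the
`A`s. An error `g` in this proportion enters only once: collect the `A₀` terms, and if their
coefficient is positive, replace `A₀` by `g * N₀ * A₁ / N₁`. -/
theorem mixture_le_of_ratio_le {α β N₀ N₁ A₀ A₁ g ρ : ℝ} (hβ : 0 ≤ β) (hαβ : β ≤ α)
    (hN₀ : 0 ≤ N₀) (hN₁ : 0 < N₁) (hA₀ : 0 ≤ A₀) (hA₁ : 0 ≤ A₁) (hg : 1 ≤ g) (hρ : 1 ≤ ρ)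
    (hN : α * N₀ + β * N₁ ≤ ρ * (β * N₀ + α * N₁)) (hA : N₁ * A₀ ≤ g * (N₀ * A₁)) :
    α * A₀ + β * A₁ ≤ g * ρ * (β * A₀ + α * A₁) := by
  have hgρ : 1 ≤ g * ρ := one_le_mul_of_one_le_of_one_le hg hρ
  have hα : 0 ≤ α := hβ.trans hαβ
  have hb : β ≤ g * ρ * α := by nlinarith
  suffices h : A₀ * (α - g * ρ * β) ≤ A₁ * (g * ρ * α - β) by linarith
  rcases le_total (α - g * ρ * β) 0 with h | h
  · exact (mul_nonpos_of_nonneg_of_nonpos hA₀ h).trans (mul_nonneg hA₁ (by linarith))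
  · refine le_of_mul_le_mul_left ?_ hN₁
    have h1 : N₁ * A₀ * (α - g * ρ * β) ≤ g * (N₀ * A₁) * (α - g * ρ * β) :=
      mul_le_mul_of_nonneg_right hA h
    have h2 : ρ * β ≤ g * ρ * β := by nlinarith [mul_nonneg (zero_le_one.trans hρ) hβ]
    have h3 : N₀ * (α - g * ρ * β) ≤ N₀ * (α - ρ * β) := by gcongr
    have h4 : N₀ * (α - ρ * β) ≤ N₁ * (ρ * α - β) := by linarith
    have h5 : g * (N₀ * (α - g * ρ * β)) ≤ g * (N₁ * (ρ * α - β)) :=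
      mul_le_mul_of_nonneg_left (h3.trans h4) (by linarith)
    have h6 : g * (N₁ * (ρ * α - β)) ≤ N₁ * (g * ρ * α - β) := by nlinarith [mul_nonneg hN₁.le hβ]
    have h7 : A₁ * (g * (N₀ * (α - g * ρ * β))) ≤ A₁ * (N₁ * (g * ρ * α - β)) :=
      mul_le_mul_of_nonneg_left (h5.trans h6) hA₁
    linarith

/-! ### Chernoff bounds for the label counts -/

section Tail

/-- Markov's inequality for the exponential moment of a sum under a product weight. -/
theorem sum_prod_tail_le {ι κ : Type*} [Fintype ι] [DecidableEq ι] [Fintype κ]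
    {m : ι → κ → ℝ} (hm : ∀ j c, 0 ≤ m j c) (f : κ → ℝ) (t : ℝ) (B : (ι → κ) → Prop)
    [DecidablePred B] (hB : ∀ L, B L → t ≤ ∑ j, f (L j)) :
    ∑ L : ι → κ, (if B L then ∏ j, m j (L j) else 0) ≤
      Real.exp (-t) * ∏ j, ∑ c, m j c * Real.exp (f c) := by
  rw [Finset.prod_univ_sum, Fintype.piFinset_univ, Finset.mul_sum]
  refine Finset.sum_le_sum fun L _ => ?_
  have h0 : 0 ≤ ∏ j, m j (L j) := Finset.prod_nonneg fun j _ => hm _ _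
  rw [Finset.prod_mul_distrib, ← Real.exp_sum, mul_left_comm, ← Real.exp_add]
  split_ifs with h
  · exact le_mul_of_one_le_right h0 (Real.one_le_exp (by linarith [hB L h]))
  · positivity

theorem prod_le_mul_pow_pred {n : ℕ} {F : Fin n → ℝ} (u : Fin n) {r r' : ℝ} (hF : ∀ j, 0 ≤ F j)
    (hu : F u ≤ r') (hj : ∀ j, j ≠ u → F j ≤ r) : ∏ j, F j ≤ r' * r ^ (n - 1) := by
  rw [← Finset.mul_prod_erase _ _ (Finset.mem_univ u)]
  refine mul_le_mul hu ?_ (Finset.prod_nonneg fun j _ => hF j) ((hF u).trans hu)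
  refine (Finset.prod_le_prod (fun j _ => hF j)
    fun j h => hj j (Finset.ne_of_mem_erase h)).trans_eq ?_
  rw [Finset.prod_const, Finset.card_erase_of_mem (Finset.mem_univ u), Finset.card_univ,
    Fintype.card_fin]

theorem labelCount_eq_sum {n : ℕ} (L : Fin n → Option Bool) (c : Bool) :
    (labelCount L c : ℝ) = ∑ j, if L j = some c then (1 : ℝ) else 0 := by
  rw [labelCount, Finset.card_filter]
  push_cast
  rfl

/-- From `cosh s ≤ exp (s²/2) ≤ 1/(1 - s²/2)`, the last being at most `1 + s²` when `s² ≤ 1`. -/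
theorem cosh_le_one_add_sq {s : ℝ} (hs : s ^ 2 ≤ 1) : Real.cosh s ≤ 1 + s ^ 2 := by
  refine (Real.cosh_le_exp_half_sq s).trans ?_
  have h := Real.one_sub_le_exp_neg (s ^ 2 / 2)
  rw [Real.exp_neg] at h
  have hp := Real.exp_pos (s ^ 2 / 2)
  have h2 : (1 - s ^ 2 / 2) * Real.exp (s ^ 2 / 2) ≤ 1 := by
    calc _ ≤ (Real.exp (s ^ 2 / 2))⁻¹ * Real.exp (s ^ 2 / 2) := by gcongr
      _ = 1 := inv_mul_cancel₀ hp.ne'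
  have h3 : 0 ≤ s ^ 2 := sq_nonneg s
  have h4 : 0 < 1 - s ^ 2 / 2 := by linarith
  refine le_of_mul_le_mul_left (h2.trans ?_) h4
  nlinarith

/-- The law of the label of user `j` when the distinguished user `u` holds datum `false`. -/
noncomputable def labelLaw {n : ℕ} (E : ℝ≥0) (u j : Fin n) (c : Option Bool) : ℝ :=
  (if j = u then labelWeight E false c else 1 : ℝ≥0) * labelMass E (j = u) c

theorem labelMass_nonneg {E : ℝ≥0} (hE : 1 < E) (s : Prop) [Decidable s] (c : Option Bool) :
    0 ≤ labelMass E s c := by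
  have h1 : (1 : ℝ) < E := by exact_mod_cast hE
  have : (1 : ℝ) / E ≤ 1 := by rw [div_le_one (by linarith)]; exact h1.le
  rcases c with _ | c
  · simp only [labelMass]; split_ifs <;> linarith
  · simp only [labelMass]; positivity

theorem labelLaw_nonneg {n : ℕ} {E : ℝ≥0} (hE : 1 < E) (u j : Fin n) (c : Option Bool) :
    0 ≤ labelLaw E u j c :=
  mul_nonneg (NNReal.coe_nonneg _) (labelMass_nonneg hE _ _)

theorem sum_labelLaw_self {n : ℕ} {E : ℝ≥0} (hE : 1 < E) (u : Fin n) (h : Option Bool → ℝ) :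
    ∑ c, labelLaw E u u c * h c =
      (E * h (some false) + h (some true)) / (E + 1) := by
  have h0 : (0 : ℝ) < E := by exact_mod_cast (zero_lt_one.trans hE)
  simp [Fintype.sum_option, labelLaw, labelMass, labelWeight]
  field_simp
  ring

theorem sum_labelLaw_of_ne {n : ℕ} {E : ℝ≥0} {u j : Fin n} (hj : j ≠ u) (h : Option Bool → ℝ) :
    ∑ c, labelLaw E u j c * h c =
      (1 - 1 / E) * h none + (h (some false) + h (some true)) / (2 * E) := by
  simp [Fintype.sum_option, labelLaw, labelMass, hj]
  ring

/-- Chernoff with tilt `-1`. With `μ = n/E`, users other than `u` contribute exponent at most `-0.6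
* 0.45 * μ` (the `0.45` uses `n ≥ 10`) and the threshold contributes `μ/8`; the sum is below `-0.145
* 16 * l`. -/
theorem sum_labelLaw_few_clones_le {n : ℕ} {E : ℝ≥0} {l : ℝ} (hE : 1 < E) (hn : (10 : ℝ) ≤ n)
    (hl0 : 0 < l) (hl : 16 * l ≤ n / E) (u : Fin n) (B : (Fin n → Option Bool) → Prop) [DecidablePred B]
    (hB : ∀ L, B L → (labelCount L true : ℝ) ≤ n / E / 8) :
    ∑ L, (if B L then ∏ j, labelLaw E u j (L j) else 0) ≤ Real.exp (-2 * l) := by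
  have h1 : (1 : ℝ) < E := by exact_mod_cast hE
  have h0 : (0 : ℝ) < E := by linarith
  have he : Real.exp (-1) ≤ 0.4 := Real.exp_neg_one_lt_d9.le.trans (by norm_num)
  refine (sum_prod_tail_le (labelLaw_nonneg hE u) (fun c => if c = some true then -1 else 0)
    (-(n / E / 8)) B fun L hL => ?_).trans ?_
  · have h : ∑ j, (if L j = some true then (-1 : ℝ) else 0) = -labelCount L true := by
      rw [labelCount_eq_sum, ← Finset.sum_neg_distrib]
      exact Finset.sum_congr rfl fun j _ => by split_ifs <;> simp
    rw [h]
    linarith [hB L hL]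
  · have hprod := prod_le_mul_pow_pred (n := n)
      (F := fun j => ∑ c, labelLaw E u j c * Real.exp (if c = some true then -1 else 0)) u
      (r := Real.exp (-(0.6 * (1 / (2 * E))))) (r' := 1)
      (fun j => Finset.sum_nonneg fun c _ =>
        mul_nonneg (labelLaw_nonneg hE u j c) (Real.exp_pos _).le)
      (by
        rw [sum_labelLaw_self hE, div_le_one (by positivity)]
        simp)
      (fun j hj => by
        rw [sum_labelLaw_of_ne hj]
        refine le_trans ?_ (Real.one_sub_le_exp_neg _)
        simp
        field_simp
        linarith)
    refine (mul_le_mul_of_nonneg_left hprod (Real.exp_pos _).le).trans ?_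
    rw [one_mul, ← Real.exp_nat_mul, ← Real.exp_add, Real.exp_le_exp]
    have hn1 : 1 ≤ n := by
      have : (1 : ℝ) ≤ n := by linarith
      exact_mod_cast this
    rw [Nat.cast_sub hn1, Nat.cast_one]
    have h3 : (0.45 : ℝ) * (n / E) ≤ (n - 1) * (1 / (2 * E)) := by
      field_simp
      linarith
    nlinarith

/-- Chernoff with tilt `s = √(l/μ)`: the threshold gives `-s - 3l`, the other users at most `l`.
User `u`, who always carries a label and favours `false`, gives at most `s`, which the `1` in the
threshold absorbs. -/
theorem sum_labelLaw_unbalanced_le {n : ℕ} {E : ℝ≥0} {l : ℝ} (hE : 1 < E) (hn : (1 : ℝ) ≤ n)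
    (hl0 : 0 < l) (hl : 16 * l ≤ n / E) (u : Fin n) (B : (Fin n → Option Bool) → Prop)
    [DecidablePred B]
    (hB : ∀ L, B L → 1 + 3 * √(l * (n / E)) ≤ (labelCount L false : ℝ) - labelCount L true) :
    ∑ L, (if B L then ∏ j, labelLaw E u j (L j) else 0) ≤ Real.exp (-2 * l) := by
  have h1 : (1 : ℝ) < E := by exact_mod_cast hE
  have h0 : (0 : ℝ) < E := by linarith
  have hμ : 0 < (n : ℝ) / E := by positivity
  set μ : ℝ := n / E with hμdef
  set s : ℝ := √(l / μ) with hsdef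
  have hs0 : 0 ≤ s := Real.sqrt_nonneg _
  have hs2 : s ^ 2 = l / μ := Real.sq_sqrt (by positivity)
  have hs1 : s ^ 2 ≤ 1 := by rw [hs2, div_le_one hμ]; linarith
  have hst : s * √(l * μ) = l := by
    rw [hsdef, ← Real.sqrt_mul (by positivity), show l / μ * (l * μ) = l ^ 2 by field_simp,
      Real.sqrt_sq hl0.le]
  let f : Option Bool → ℝ := fun c => s * ((if c = some false then 1 else 0) -
    (if c = some true then 1 else 0))
  refine (sum_prod_tail_le (labelLaw_nonneg hE u) f (s * (1 + 3 * √(l * μ))) B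
    fun L hL => ?_).trans ?_
  · rw [← Finset.mul_sum, Finset.sum_sub_distrib, ← labelCount_eq_sum, ← labelCount_eq_sum]
    exact mul_le_mul_of_nonneg_left (hB L hL) hs0
  · have hprod := prod_le_mul_pow_pred (n := n)
      (F := fun j => ∑ c, labelLaw E u j c * Real.exp (f c)) u
      (r := Real.exp (s ^ 2 / E)) (r' := Real.exp s)
      (fun j => Finset.sum_nonneg fun c _ =>
        mul_nonneg (labelLaw_nonneg hE u j c) (Real.exp_pos _).le)
      (by
        rw [sum_labelLaw_self hE, div_le_iff₀ (by positivity)]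
        have : Real.exp (-s) ≤ Real.exp s := Real.exp_le_exp.2 (by linarith)
        simp [f]
        linarith)
      (fun j hj => by
        rw [sum_labelLaw_of_ne hj]
        refine le_trans ?_ (Real.add_one_le_exp _)
        have hc := cosh_le_one_add_sq hs1
        rw [Real.cosh_eq] at hc
        simp [f]
        field_simp
        linarith)
    refine (mul_le_mul_of_nonneg_left hprod (Real.exp_pos _).le).trans ?_
    rw [← Real.exp_nat_mul, ← Real.exp_add, ← Real.exp_add, Real.exp_le_exp]
    have hn1 : ((n - 1 : ℕ) : ℝ) ≤ n := by exact_mod_cast Nat.sub_le n 1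
    have h3 : ((n - 1 : ℕ) : ℝ) * (s ^ 2 / E) ≤ l := by
      calc ((n - 1 : ℕ) : ℝ) * (s ^ 2 / E) ≤ n * (s ^ 2 / E) := by gcongr
        _ = s ^ 2 * μ := by rw [hμdef]; ring
        _ = l := by rw [hs2]; field_simp
    linarith [hst]

end Tail

/-! ### Amplification for the composed protocol -/

section Amplification

variable {n : ℕ} {D X : Type*} [MeasurableSpace X]

/-- Simultaneous clone decomposition of all local randomizers: the label `some b` marks a message
distributed independently of the user who sends it. -/
theorem exists_labelled_decomposition {E : ℝ≥0} (hE : 1 < E) {R : Fin n → D → Measure X}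
    (hR : ∀ i d, IsProbabilityMeasure (R i d))
    (hE' : ∀ i d d' T, MeasurableSet T → (R i d).real T ≤ E * (R i d').real T)
    {x x' : Fin n → D} {u : Fin n} (hx : ∀ j, j ≠ u → x j = x' j) :
    ∃ κ : Fin n → Fin n → Option Bool → Measure X,
      (∀ i j c, IsFiniteMeasure (κ i j c)) ∧
      (∀ i j k c, c ≠ none → κ i j c = κ i k c) ∧
      (∀ i j c, (κ i j c).real Set.univ = labelMass E (j = u) c) ∧
      (∀ i j, R i (x j) = ∑ c, (if j = u then labelWeight E false c else 1) • κ i j c) ∧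
      ∀ i j, R i (x' j) = ∑ c, (if j = u then labelWeight E true c else 1) • κ i j c := by
  choose P Q hP hQ hPm hQm hdec hmix using fun i =>
    exists_clone_decomposition hE (hR i) (hE' i) (fun v : Bool => if v then x' u else x u)
  let κ : Fin n → Fin n → Option Bool → Measure X := fun i j c =>
    c.elim (if j = u then 0 else Q i (x j)) (P i)
  refine ⟨κ, ?_, ?_, ?_, ?_, ?_⟩
  · rintro i j (_ | c)
    · simp only [κ, Option.elim]
      split_ifs
      · infer_instance
      · exact hQ _ _
    · exact hP i c
  · rintro i j k (_ | c) hc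
    · exact absurd rfl hc
    · rfl
  · rintro i j (_ | c)
    · by_cases h : j = u <;> simp [κ, labelMass, h, hQm]
    · simp [κ, labelMass, hPm]
  · intro i j
    by_cases h : j = u
    · subst h
      have := hmix i false
      simp only [Bool.false_eq_true, if_false] at this
      simp [κ, Fintype.sum_option, this]
    · simp [κ, Fintype.sum_option, h, hdec]
  · intro i j
    by_cases h : j = u
    · subst h
      have := hmix i true
      simp only [if_true] at this
      simp [κ, Fintype.sum_option, this]
    · simp [κ, Fintype.sum_option, h, ← hx j h, hdec]

/-- Labels are indexed by output position, so that `L` can be held fixed while `π` varies; the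
weight of `u` is then read at its position `π⁻¹ u`. -/
theorem composedProtocol_real_eq_sum (S : PMF (Equiv.Perm (Fin n))) {R : Fin n → D → Measure X}
    {x : Fin n → D} {u : Fin n} (w : Option Bool → ℝ≥0)
    (κ : Fin n → Fin n → Option Bool → Measure X) [∀ i j c, IsFiniteMeasure (κ i j c)]
    (hκ : ∀ i j, R i (x j) = ∑ c, (if j = u then w c else 1) • κ i j c) (T : Set (Fin n → X)) :
    (composedProtocol S R x).real T = ∑ L : Fin n → Option Bool, ∑ π, (S π).toReal *
      (w (L (π⁻¹ u)) * (Measure.pi fun i => κ i (π i) (L i)).real T) := by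
  have hpi : ∀ π : Equiv.Perm (Fin n), Measure.pi (fun i => R i (x (π i))) =
      ∑ L : Fin n → Option Bool, w (L (π⁻¹ u)) • Measure.pi fun i => κ i (π i) (L i) := by
    intro π
    simp only [hκ]
    rw [pi_sum_eq_sum_pi]
    refine Finset.sum_congr rfl fun L _ => ?_
    rw [← pi_ite_smul (fun i => κ i (π i) (L i)) (fun i => w (L i)) (π⁻¹ u)]
    simp only [Equiv.Perm.eq_inv_iff_eq]
  rw [composedProtocol, measureReal_def, Measure.finsetSum_apply, ENNReal.toReal_sum]
  · rw [Finset.sum_comm]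
    refine Finset.sum_congr rfl fun π _ => ?_
    rw [← measureReal_def, measureReal_ennreal_smul_apply, hpi, measureReal_sum_apply,
      Finset.mul_sum]
    simp only [measureReal_nnreal_smul_apply]
  · intro π _
    rw [hpi]
    exact ENNReal.mul_ne_top (S.apply_ne_top π) (measure_ne_top _ _)

/-- On balanced label counts with enough clones, the two mixtures of label counts are close. -/
theorem label_ratio_le {E l μ N₀ N₁ : ℝ} (hE : 1 < E) (hl : 1 / 2 ≤ l) (hμ : 16 * l ≤ μ)
    (hN₀ : 0 ≤ N₀) (hN₁ : μ / 8 ≤ N₁) (hN : N₀ - N₁ ≤ 1 + 3 * √(l * μ)) :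
    2 * E ^ 2 / (E + 1) * N₀ + 2 * E / (E + 1) * N₁ ≤
      Real.exp (32 * (1 - 1 / E) * √(l / μ)) *
        (2 * E / (E + 1) * N₀ + 2 * E ^ 2 / (E + 1) * N₁) := by
  have hμ0 : 0 < μ := by linarith
  have hl0 : 0 < l := by linarith
  have hE0 : 0 < E := by linarith
  have hden : 0 < E + 1 := by linarith
  have h1E : 0 ≤ 1 - 1 / E := by rw [sub_nonneg, div_le_one hE0]; exact hE.le
  set y : ℝ := 32 * (1 - 1 / E) * √(l / μ) with hy
  have hy0 : 0 ≤ y := by positivity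
  have hmix : 0 ≤ 2 * E / (E + 1) * N₀ + 2 * E ^ 2 / (E + 1) * N₁ := by
    have : 0 ≤ N₁ := by linarith
    positivity
  refine le_trans ?_ (mul_le_mul_of_nonneg_right (Real.add_one_le_exp y) hmix)
  rw [div_mul_eq_mul_div, div_mul_eq_mul_div, div_mul_eq_mul_div, div_mul_eq_mul_div, ← add_div,
    ← add_div, mul_div_assoc', div_le_div_iff_of_pos_right hden]
  -- After dividing by `2E/(E+1)`, this is `E N₀ + N₁ ≤ (1 + y)(N₀ + E N₁)`.
  suffices h : (E - 1) * (N₀ - N₁) ≤ y * (N₀ + E * N₁) by nlinarith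
  rcases le_total N₀ N₁ with h | h
  · have h1 : (E - 1) * (N₀ - N₁) ≤ 0 :=
      mul_nonpos_of_nonneg_of_nonpos (by linarith) (by linarith)
    have h2 : 0 ≤ y * (N₀ + E * N₁) := by
      have : 0 ≤ N₁ := by linarith
      positivity
    linarith
  · have hroot : √(l * μ) = √(l / μ) * μ := by
      rw [show l * μ = l / μ * μ ^ 2 by field_simp, Real.sqrt_mul (by positivity),
        Real.sqrt_sq hμ0.le]
    have hone : 1 ≤ √(l * μ) := Real.one_le_sqrt.2 (by nlinarith)
    have h1 : N₀ - N₁ ≤ 4 * (√(l / μ) * μ) := by rw [← hroot]; linarith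
    have h2 : (E + 1) * (μ / 8) ≤ N₀ + E * N₁ := by nlinarith
    calc (E - 1) * (N₀ - N₁) ≤ (E - 1) * (4 * (√(l / μ) * μ)) :=
          mul_le_mul_of_nonneg_left h1 (by linarith)
      _ = y * (E * (μ / 8)) := by rw [hy]; field_simp; ring
      _ ≤ y * ((E + 1) * (μ / 8)) := by gcongr; linarith
      _ ≤ y * (N₀ + E * N₁) := by gcongr

/-- The amplification bound for the composed protocol on neighbouring datasets. -/
theorem composedProtocol_real_le {S : PMF (Equiv.Perm (Fin n))} {g : ℝ} (hg : 1 ≤ g)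
    (hS : ∀ π i k, i ≠ k → (S π).toReal ≤ g * (S (π * Equiv.swap i k)).toReal)
    {E : ℝ≥0} (hE : 1 < E) {R : Fin n → D → Measure X}
    (hR : ∀ i d, IsProbabilityMeasure (R i d))
    (hE' : ∀ i d d' T, MeasurableSet T → (R i d).real T ≤ E * (R i d').real T)
    {x x' : Fin n → D} {u : Fin n} (hx : ∀ j, j ≠ u → x j = x' j) {l : ℝ} (hl : 5 / 8 ≤ l)
    (hμ : 16 * l ≤ n / E) (T : Set (Fin n → X)) :
    (composedProtocol S R x).real T ≤
      g * Real.exp (32 * (1 - 1 / E) * √(l / (n / E))) * (composedProtocol S R x').real T +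
        2 * Real.exp (-2 * l) := by
  classical
  obtain ⟨κ, hκf, hκ, hκm, hx1, hx2⟩ := exists_labelled_decomposition hE hR hE' hx
  have h1 : (1 : ℝ) < E := by exact_mod_cast hE
  have h0 : (0 : ℝ) < E := by linarith
  have hn : (10 : ℝ) ≤ n := by
    have : 16 * l * E ≤ n := (le_div_iff₀ h0).1 hμ
    nlinarith
  set ρ : ℝ := Real.exp (32 * (1 - 1 / E) * √(l / (n / E))) with hρdef
  have hρ : 1 ≤ ρ := by
    refine Real.one_le_exp ?_
    have : 0 ≤ 1 - 1 / (E : ℝ) := by rw [sub_nonneg, div_le_one h0]; exact h1.le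
    positivity
  rw [composedProtocol_real_eq_sum S _ κ hx1, composedProtocol_real_eq_sum S _ κ hx2]
  set G : Equiv.Perm (Fin n) → (Fin n → Option Bool) → ℝ :=
    fun π L => (Measure.pi fun i => κ i (π i) (L i)).real T with hG
  have hG0 : ∀ π L, 0 ≤ G π L := fun _ _ => measureReal_nonneg
  have hgρ : 1 ≤ g * ρ := one_le_mul_of_one_le_of_one_le hg hρ
  let few : (Fin n → Option Bool) → Prop := fun L => (labelCount L true : ℝ) ≤ n / E / 8
  let unbal : (Fin n → Option Bool) → Prop := fun L =>
    1 + 3 * √(l * (n / E)) ≤ (labelCount L false : ℝ) - labelCount L true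
  have hgood : ∀ L, ¬ few L → ¬ unbal L →
      ∑ π, (S π).toReal * (labelWeight E false (L (π⁻¹ u)) * G π L) ≤
        g * ρ * ∑ π, (S π).toReal * (labelWeight E true (L (π⁻¹ u)) * G π L) := by
    intro L hL1 hL2
    simp only [few, unbal, not_le] at hL1 hL2
    let A : Option Bool → ℝ := fun c =>
      ∑ π : Equiv.Perm (Fin n), (if L (π⁻¹ u) = c then (S π).toReal * G π L else 0)
    have hA0 : ∀ c, 0 ≤ A c := fun c => Finset.sum_nonneg fun π _ => by
      split_ifs
      · exact mul_nonneg ENNReal.toReal_nonneg (hG0 _ _)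
      · exact le_rfl
    have hsplit : ∀ v, ∑ π, (S π).toReal * (labelWeight E v (L (π⁻¹ u)) * G π L) =
        A none + (labelWeight E v (some false) * A (some false) +
          labelWeight E v (some true) * A (some true)) := by
      intro v
      simp only [A]
      rw [Finset.mul_sum, Finset.mul_sum, ← Finset.sum_add_distrib, ← Finset.sum_add_distrib]
      refine Finset.sum_congr rfl fun π _ => ?_
      rcases L (π⁻¹ u) with _ | _ | _
      · simp [labelWeight]
      · simp; ring
      · simp; ring
    have hswap := labelCount_mul_sum_le (S := fun π => (S π).toReal) (G := fun π => G π L) (L := L)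
      (fun π => hG0 π L) hS (fun π i k hi hk => by
        simp only [hG]
        congr 2
        funext i'
        rw [Equiv.Perm.mul_apply]
        -- Unlabelled positions are not moved by the swap; at labelled ones the sender is
        -- irrelevant.
        by_cases h : L i' = none
        · rw [Equiv.swap_apply_of_ne_of_ne]
          · rintro rfl; exact hi h
          · rintro rfl; exact hk h
        · exact hκ _ _ _ _ h) u
    have hratio := label_ratio_le h1 (by linarith) hμ (Nat.cast_nonneg (labelCount L false))
      hL1.le hL2.le
    have hβ : (0 : ℝ) ≤ 2 * E / (E + 1) := by positivity
    have hαβ : (2 * E / (E + 1) : ℝ) ≤ 2 * E ^ 2 / (E + 1) := by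
      gcongr
      nlinarith
    have hN1 : (0 : ℝ) < labelCount L true := lt_of_le_of_lt (by positivity) hL1
    have hfin := mixture_le_of_ratio_le hβ hαβ (Nat.cast_nonneg _) hN1 (hA0 (some false))
      (hA0 (some true)) hg hρ hratio hswap
    rw [hsplit, hsplit]
    simp only [labelWeight, if_true, Bool.false_eq_true, Bool.true_eq_false, if_false]
    push_cast
    -- The `none` class has weight 1 for both data, so `1 ≤ g * ρ` suffices there.
    nlinarith [hA0 none]
  -- Dropping `T` leaves total masses, which factor over users into the independent label laws.
  have hmass : ∀ L, ∑ π, (S π).toReal * (labelWeight E false (L (π⁻¹ u)) * G π L) ≤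
      ∑ π : Equiv.Perm (Fin n), (S π).toReal * ∏ j, labelLaw E u j (L (π⁻¹ j)) := by
    intro L
    refine Finset.sum_le_sum fun π _ => mul_le_mul_of_nonneg_left ?_ ENNReal.toReal_nonneg
    have hGle : G π L ≤ ∏ j, labelMass E (j = u) (L (π⁻¹ j)) := by
      refine (measureReal_mono (Set.subset_univ T)).trans_eq ?_
      rw [measureReal_def, Measure.pi_univ, ENNReal.toReal_prod,
        ← Equiv.prod_comp π fun j => labelMass E (j = u) (L (π⁻¹ j))]
      refine Finset.prod_congr rfl fun i _ => ?_
      rw [show π⁻¹ (π i) = i from π.symm_apply_apply i]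
      exact hκm i (π i) (L i)
    refine (mul_le_mul_of_nonneg_left hGle (NNReal.coe_nonneg _)).trans_eq ?_
    simp only [labelLaw]
    rw [Finset.prod_mul_distrib]
    congr 1
    rw [Finset.prod_eq_single u (by intro b _ hb; simp [hb]) (by simp)]
    simp
  have htail : ∀ B : (Fin n → Option Bool) → Prop,
      (∀ (π : Equiv.Perm (Fin n)) L, B (fun i => L (π i)) ↔ B L) →
      ∑ L, (if B L then ∏ j, labelLaw E u j (L j) else 0) ≤ Real.exp (-2 * l) →
      ∑ L, (if B L then ∑ π : Equiv.Perm (Fin n), (S π).toReal *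
        ∏ j, labelLaw E u j (L (π⁻¹ j)) else 0) ≤ Real.exp (-2 * l) := by
    intro B hB hle
    have hsum : ∑ π, (S π).toReal = 1 := by
      rw [← ENNReal.toReal_sum (fun π _ => S.apply_ne_top π),
        (tsum_fintype _).symm.trans S.tsum_coe, ENNReal.toReal_one]
    calc _ = ∑ π : Equiv.Perm (Fin n), (S π).toReal *
          ∑ L, (if B L then ∏ j, labelLaw E u j (L (π⁻¹ j)) else 0) := by
          simp only [Finset.mul_sum]
          rw [Finset.sum_comm]
          refine Finset.sum_congr rfl fun L _ => ?_
          split_ifs <;> simp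
      _ = ∑ π : Equiv.Perm (Fin n), (S π).toReal *
          ∑ L, (if B L then ∏ j, labelLaw E u j (L j) else 0) := by
          refine Finset.sum_congr rfl fun π _ => ?_
          congr 1
          rw [← Equiv.sum_comp (Equiv.arrowCongr π⁻¹ (Equiv.refl (Option Bool)))
            fun L => if B L then ∏ j, labelLaw E u j (L (π⁻¹ j)) else 0]
          refine Finset.sum_congr rfl fun L _ => ?_
          have he : (Equiv.arrowCongr π⁻¹ (Equiv.refl (Option Bool))) L = fun i => L (π i) := rfl
          rw [he]
          simp only [hB, show ∀ j, π (π⁻¹ j) = j from π.apply_symm_apply]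
      _ ≤ 1 * Real.exp (-2 * l) := by
          rw [← Finset.sum_mul, hsum]
          exact mul_le_mul_of_nonneg_left hle zero_le_one
      _ = _ := one_mul _
  have hfew := htail few (fun π L => by simp only [few, labelCount_comp_perm])
    (sum_labelLaw_few_clones_le hE hn (by linarith) hμ u few fun L h => h)
  have hunbal := htail unbal (fun π L => by simp only [unbal, labelCount_comp_perm])
    (sum_labelLaw_unbalanced_le hE (by linarith) (by linarith) hμ u unbal fun L h => h)
  have hnn : ∀ v L, 0 ≤ ∑ π, (S π).toReal * (labelWeight E v (L (π⁻¹ u)) * G π L) := fun v L =>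
    Finset.sum_nonneg fun π _ => mul_nonneg ENNReal.toReal_nonneg
      (mul_nonneg (NNReal.coe_nonneg _) (hG0 _ _))
  have hnn' : ∀ B : (Fin n → Option Bool) → Prop, ∀ L, 0 ≤ if B L then
      ∑ π : Equiv.Perm (Fin n), (S π).toReal * ∏ j, labelLaw E u j (L (π⁻¹ j)) else 0 := by
    intro B L
    split_ifs
    · exact Finset.sum_nonneg fun π _ => mul_nonneg ENNReal.toReal_nonneg
        (Finset.prod_nonneg fun j _ => labelLaw_nonneg hE u j _)
    · exact le_rfl
  -- Bad label vectors are charged their whole mass; overlap of the two bad events only helps.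
  have hall : ∀ L, ∑ π, (S π).toReal * (labelWeight E false (L (π⁻¹ u)) * G π L) ≤
      g * ρ * ∑ π, (S π).toReal * (labelWeight E true (L (π⁻¹ u)) * G π L) +
      ((if few L then ∑ π : Equiv.Perm (Fin n), (S π).toReal *
        ∏ j, labelLaw E u j (L (π⁻¹ j)) else 0) +
      (if unbal L then ∑ π : Equiv.Perm (Fin n), (S π).toReal *
        ∏ j, labelLaw E u j (L (π⁻¹ j)) else 0)) := by
    intro L
    have hm := hmass L
    have hn1 := mul_nonneg (zero_le_one.trans hgρ) (hnn true L)
    have hf := hnn' few L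
    have hu := hnn' unbal L
    by_cases h1 : few L
    · rw [if_pos h1]
      linarith
    · by_cases h2 : unbal L
      · rw [if_pos h2]
        linarith
      · have := hgood L h1 h2
        linarith
  refine (Finset.sum_le_sum fun L _ => hall L).trans ?_
  rw [Finset.sum_add_distrib, Finset.sum_add_distrib, ← Finset.mul_sum]
  linarith

end Amplification

/-! ### Privacy parameters and the two protocols -/

section Protocols

variable {n : ℕ} {D X : Type*} [MeasurableSpace X]

theorem isProbabilityMeasure_composedProtocol (S : PMF (Equiv.Perm (Fin n)))
    {R : Fin n → D → Measure X} (hR : ∀ i d, IsProbabilityMeasure (R i d)) (x : Fin n → D) :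
    IsProbabilityMeasure (composedProtocol S R x) := by
  constructor
  rw [composedProtocol, Measure.finsetSum_apply]
  simp only [Measure.smul_apply, measure_univ, smul_eq_mul, mul_one]
  exact (tsum_fintype _).symm.trans S.tsum_coe

/-- With a common local randomizer, randomizing before or after shuffling is the same. -/
theorem randomizeThenShuffle_eq_composedProtocol (S : PMF (Equiv.Perm (Fin n)))
    {R : D → Measure X} (hR : ∀ d, IsProbabilityMeasure (R d)) (x : Fin n → D) :
    randomizeThenShuffle S R x = composedProtocol S (fun _ => R) x := by
  refine Finset.sum_congr rfl fun π _ => ?_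
  congr 1
  refine (Measure.pi_eq fun s hs => ?_).symm
  have hmeas : Measurable fun (y : Fin n → X) i => y (π i) :=
    measurable_pi_lambda _ fun i => measurable_pi_apply _
  rw [Measure.map_apply hmeas (MeasurableSet.univ_pi hs)]
  have hpre : (fun (y : Fin n → X) i => y (π i)) ⁻¹' Set.univ.pi s =
      Set.univ.pi fun j => s (π⁻¹ j) := by
    ext y
    simp only [Set.mem_preimage, Set.mem_univ_pi]
    refine ⟨fun h j => ?_, fun h i => ?_⟩
    · have := h (π⁻¹ j)
      rwa [show π (π⁻¹ j) = j from π.apply_symm_apply j] at this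
    · have := h (π i)
      rwa [show π⁻¹ (π i) = i from π.symm_apply_apply i] at this
  rw [hpre, Measure.pi_pi, ← Equiv.prod_comp π]
  refine Finset.prod_congr rfl fun i _ => ?_
  rw [show π⁻¹ (π i) = i from π.symm_apply_apply i]

theorem isDP_of_real_le {A Y : Type*} [MeasurableSpace Y] {nbr : A → A → Prop}
    {M : A → Measure Y} [∀ a, IsFiniteMeasure (M a)] {ε δ : ℝ} (hδ : 0 ≤ δ)
    (h : ∀ x x', nbr x x' → ∀ T, (M x).real T ≤ Real.exp ε * (M x').real T + δ) :
    IsDP nbr M ε δ := by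
  intro x x' hx T _
  rw [← ofReal_measureReal (μ := M x), ← ofReal_measureReal (μ := M x'),
    ← ENNReal.ofReal_mul (Real.exp_pos _).le,
    ← ENNReal.ofReal_add (mul_nonneg (Real.exp_pos _).le measureReal_nonneg) hδ]
  exact ENNReal.ofReal_le_ofReal (h x x' hx T)

theorem IsLocalRandomizer.real_le {ε₀ : ℝ} {R : D → Measure X} (hR : IsLocalRandomizer ε₀ R)
    (d d' : D) {T : Set X} (hT : MeasurableSet T) :
    (R d).real T ≤ Real.exp ε₀ * (R d').real T := by
  have := hR.1
  have h := hR.2 d d' trivial T hT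
  rw [ENNReal.ofReal_zero, add_zero] at h
  have h' := ENNReal.toReal_mono (ENNReal.mul_ne_top ENNReal.ofReal_ne_top
    (measure_ne_top _ _)) h
  rwa [ENNReal.toReal_mul, ENNReal.toReal_ofReal (Real.exp_pos _).le] at h'

/-- The amplification bound in terms of the privacy parameters. -/
theorem composedProtocol_real_le_exp {ε₀ γ l : ℝ} (hε₀ : 0 < ε₀) (hγ : 0 < γ) (hl : 5 / 8 ≤ l)
    (hln : 16 * l * Real.exp ε₀ ≤ n) {S : PMF (Equiv.Perm (Fin n))} (hS : IsImperfectShuffler γ S)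
    {R : Fin n → D → Measure X} (hR : ∀ i, IsLocalRandomizer ε₀ (R i)) {x x' : Fin n → D}
    (hx : Neighboring x x') (T : Set (Fin n → X)) :
    (composedProtocol S R x).real T ≤
      Real.exp (32 * ((1 - Real.exp (-ε₀)) * Real.exp (ε₀ / 2) * √l / √n) + γ) *
        (composedProtocol S R x').real T + 2 * Real.exp (-2 * l) := by
  obtain ⟨u, hu⟩ := hx
  have hE0 := Real.exp_pos ε₀
  obtain ⟨E, hE⟩ : ∃ E : ℝ≥0, (E : ℝ) = Real.exp ε₀ :=
    ⟨(Real.exp ε₀).toNNReal, Real.coe_toNNReal _ hE0.le⟩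
  have key := composedProtocol_real_le (E := E)
    (Real.one_le_exp hγ.le) (fun π i k hik => hS.toReal_le_swap hγ.le π hik)
    (NNReal.coe_lt_coe.1 (by rw [hE]; simpa using hε₀)) (fun i => (hR i).1)
    (fun i d d' T hT => by rw [hE]; exact (hR i).real_le d d' hT) hu hl
    (by rw [hE, le_div_iff₀ hE0]; exact hln) T
  rw [hE] at key
  have he : 32 * (1 - 1 / Real.exp ε₀) * √(l / (n / Real.exp ε₀)) =
      32 * ((1 - Real.exp (-ε₀)) * Real.exp (ε₀ / 2) * √l / √n) := by
    rw [show l / (n / Real.exp ε₀) = Real.exp ε₀ * l / n by field_simp,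
      Real.sqrt_div (mul_nonneg hE0.le (by linarith)), Real.sqrt_mul hE0.le, Real.exp_half,
      Real.exp_neg]
    ring
  rw [he, ← Real.exp_add, add_comm γ] at key
  exact key

/-- The universal constant of the amplification theorem. -/
noncomputable def amplificationConstant : ℝ := 32 * √(1 + 2 * Real.exp 8)

theorem amplificationConstant_pos : 0 < amplificationConstant := by
  unfold amplificationConstant
  positivity

/-- Replaces `log (2/δ)` by `log (1/δ)` at constant cost, which requires `δ` bounded away from 1;
the cutoff matches the bound `y ≤ 8` in `isDP_composedProtocol`. -/
theorem log_two_div_le {δ : ℝ} (hδ : 0 < δ) (hδ1 : δ ≤ 1 - Real.exp (-8) / 2) :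
    Real.log (2 / δ) ≤ (1 + 2 * Real.exp 8) * Real.log (1 / δ) := by
  have h1 : Real.exp (-8) / 2 ≤ Real.log (1 / δ) := by
    rw [one_div, Real.log_inv]
    linarith [Real.log_le_sub_one_of_pos hδ]
  have h2 : Real.exp 8 * Real.exp (-8) = 1 := by rw [← Real.exp_add]; simp
  have h3 : 1 ≤ 2 * Real.exp 8 * Real.log (1 / δ) := by
    nlinarith [mul_le_mul_of_nonneg_left h1 (Real.exp_pos 8).le]
  have h4 : Real.log (2 / δ) = Real.log 2 + Real.log (1 / δ) := by
    rw [← Real.log_mul (by norm_num) (by positivity)]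
    congr 1
    ring
  linarith [Real.log_two_lt_d9]

theorem isDP_composedProtocol {ε₀ γ δ : ℝ} (hn : 0 < n) (hε₀ : 0 < ε₀) (hγ : 0 < γ) (hδ : 0 < δ)
    (hδ1 : δ < 1) (hcond : ε₀ ≤ Real.log (n / (16 * Real.log (2 / δ))))
    {S : PMF (Equiv.Perm (Fin n))} (hS : IsImperfectShuffler γ S)
    {R : Fin n → D → Measure X} (hR : ∀ i, IsLocalRandomizer ε₀ (R i)) :
    IsDP Neighboring (composedProtocol S R)
      (amplificationConstant * ((1 - Real.exp (-ε₀)) * Real.exp (ε₀ / 2) *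
        √(Real.log (1 / δ)) / √n) + γ) δ := by
  have hprob := isProbabilityMeasure_composedProtocol S fun i => (hR i).1
  refine isDP_of_real_le hδ.le fun x x' hx T => ?_
  set l : ℝ := Real.log (2 / δ) with hldef
  have hn' : (0 : ℝ) < n := by exact_mod_cast hn
  -- `5/8` is a rational lower bound for `log 2`, large enough that `16 * l * E ≤ n` forces `n ≥
  -- 10`.
  have hl : 5 / 8 ≤ l := by
    have h : Real.log 2 ≤ l :=
      Real.log_le_log (by norm_num) (by rw [le_div_iff₀ hδ]; linarith)
    linarith [Real.log_two_gt_d9]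
  have hln : 16 * l * Real.exp ε₀ ≤ n := by
    rw [Real.le_log_iff_exp_le (by positivity), le_div_iff₀ (by positivity)] at hcond
    linarith
  have h1e : 0 ≤ 1 - Real.exp (-ε₀) := by
    rw [sub_nonneg, Real.exp_le_one_iff]; linarith
  have key := composedProtocol_real_le_exp hε₀ hγ hl hln hS hR hx T
  have htail : 2 * Real.exp (-2 * l) ≤ δ / 2 := by
    have h : Real.exp (-2 * l) = (δ / 2) ^ 2 := by
      rw [show -2 * l = -l + -l by ring, Real.exp_add, hldef, ← Real.log_inv,
        Real.exp_log (by positivity), inv_div, sq]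
    rw [h]
    nlinarith
  set y : ℝ := 32 * ((1 - Real.exp (-ε₀)) * Real.exp (ε₀ / 2) * √l / √n) with hy
  have hM' : 0 ≤ (composedProtocol S R x').real T := measureReal_nonneg
  -- As `δ → 1` the target `ε` vanishes but `y` need not. There `δ` itself pays: `y ≤ 8`, so mixing
  -- the bound with weight `exp (-y)` and `M ≤ 1` with the remaining weight leaves an additive error
  -- of at most `1 - exp (-8) / 2 < δ`.
  rcases le_or_gt δ (1 - Real.exp (-8) / 2) with hsmall | hlarge
  · have hle : y ≤ amplificationConstant * ((1 - Real.exp (-ε₀)) * Real.exp (ε₀ / 2) *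
        √(Real.log (1 / δ)) / √n) := by
      have hs : √l ≤ √(1 + 2 * Real.exp 8) * √(Real.log (1 / δ)) := by
        rw [← Real.sqrt_mul (by positivity)]
        exact Real.sqrt_le_sqrt (log_two_div_le hδ hsmall)
      calc y ≤ 32 * ((1 - Real.exp (-ε₀)) * Real.exp (ε₀ / 2) *
            (√(1 + 2 * Real.exp 8) * √(Real.log (1 / δ))) / √n) := by rw [hy]; gcongr
        _ = _ := by rw [amplificationConstant]; ring
    refine key.trans (add_le_add (mul_le_mul_of_nonneg_right ?_ hM') (by linarith))
    exact Real.exp_le_exp.2 (by linarith)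
  · have hy8 : y ≤ 8 := by
      -- The `1/4` is the square root of the `1/16` in the hypothesis on `ε₀`.
      have hroot : Real.exp (ε₀ / 2) * √l / √n ≤ 1 / 4 := by
        rw [Real.exp_half, ← Real.sqrt_mul (Real.exp_pos _).le, ← Real.sqrt_div (by positivity)]
        refine Real.sqrt_le_iff.2 ⟨by norm_num, ?_⟩
        rw [div_le_iff₀ hn']
        linarith
      have hpos : 0 ≤ Real.exp (ε₀ / 2) * √l / √n := by positivity
      have h1 : 1 - Real.exp (-ε₀) ≤ 1 := by linarith [Real.exp_pos (-ε₀)]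
      calc y = 32 * ((1 - Real.exp (-ε₀)) * (Real.exp (ε₀ / 2) * √l / √n)) := by rw [hy]; ring
        _ ≤ 32 * (1 * (1 / 4)) := by gcongr
        _ = 8 := by norm_num
    have hy0 : 0 ≤ y := by positivity
    have hM1 : (composedProtocol S R x).real T ≤ 1 := measureReal_le_one
    set M := (composedProtocol S R x).real T
    set M' := (composedProtocol S R x').real T
    have ha1 : Real.exp (-y) ≤ 1 := Real.exp_le_one_iff.2 (by linarith)
    have ha2 : Real.exp (-8) ≤ Real.exp (-y) := Real.exp_le_exp.2 (by linarith)
    have hscaled : Real.exp (-y) * M ≤ Real.exp γ * M' + Real.exp (-y) * (1 / 2) := by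
      refine (mul_le_mul_of_nonneg_left key (Real.exp_pos (-y)).le).trans ?_
      rw [mul_add, ← mul_assoc, ← Real.exp_add, neg_add_cancel_left]
      have : Real.exp (-y) * (2 * Real.exp (-2 * l)) ≤ Real.exp (-y) * (1 / 2) := by
        gcongr
        linarith
      linarith
    have hrest : (1 - Real.exp (-y)) * M ≤ 1 - Real.exp (-y) :=
      mul_le_of_le_one_right (by linarith) hM1
    have hexp : Real.exp γ * M' ≤ Real.exp (amplificationConstant * ((1 - Real.exp (-ε₀)) *
        Real.exp (ε₀ / 2) * √(Real.log (1 / δ)) / √n) + γ) * M' := by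
      refine mul_le_mul_of_nonneg_right (Real.exp_le_exp.2 ?_) hM'
      have : 0 ≤ amplificationConstant * ((1 - Real.exp (-ε₀)) *
          Real.exp (ε₀ / 2) * √(Real.log (1 / δ)) / √n) :=
        mul_nonneg amplificationConstant_pos.le (by positivity)
      linarith
    linarith

end Protocols
theorem mainTheorem4 :
    ∃ C : ℝ, 0 < C ∧
      ∀ (D X : Type*) [MeasurableSpace X] (n : ℕ) (ε₀ γ δ : ℝ),
        0 < n → 0 < ε₀ → 0 < γ → 0 < δ → δ < 1 →
        ε₀ ≤ Real.log (n / (16 * Real.log (2 / δ))) →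
        ∀ S : PMF (Equiv.Perm (Fin n)), IsImperfectShuffler γ S →
          (∀ R : Fin n → D → Measure X, (∀ i, IsLocalRandomizer ε₀ (R i)) →
            IsDP Neighboring (composedProtocol S R)
              (C * ((1 - Real.exp (-ε₀)) * Real.exp (ε₀ / 2) * √(Real.log (1 / δ)) / √n) + γ)
              δ) ∧
          (∀ R : D → Measure X, IsLocalRandomizer ε₀ R →
            IsDP Neighboring (randomizeThenShuffle S R)
              (C * ((1 - Real.exp (-ε₀)) * Real.exp (ε₀ / 2) * √(Real.log (1 / δ)) / √n) + γ)
              δ) := by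
  refine ⟨amplificationConstant, amplificationConstant_pos, ?_⟩
  intro D X _ n ε₀ γ δ hn hε₀ hγ hδ hδ1 hcond S hS
  refine ⟨fun R hR => isDP_composedProtocol hn hε₀ hγ hδ hδ1 hcond hS hR, fun R hR => ?_⟩
  have heq : randomizeThenShuffle S R = composedProtocol S (fun _ => R) :=
    funext fun x => randomizeThenShuffle_eq_composedProtocol S hR.1 x
  rw [heq]
  exact isDP_composedProtocol hn hε₀ hγ hδ hδ1 hcond hS fun _ => hR
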